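/- **Setting.** Let $m,n\ge 3$ be odd integers. The $m\times n$ projective grid graph $\mathcal P_{m,n}$ has vertices $(i,j)$, $1\le i\le m$, $1\le j\le n$, and edges joining $(i,j)$ to $(i,j+1)$ for $1\le i\le m$, $1\le j<n$; $(i,j)$ to $(i+1,j)$ for $1\le i<m$, $1\le j\le n$; $(i,n)$ to $(m+1-i,1)$ for $1\le i\le m$; and $(m,j)$ to $(1,n+1-j)$ for $1\le j\le n$. It is embedded naturally in the projective plane. Its faces are the two digons $\{(1,1),(m,n)\}$ and $\{(m,1),(1,n)\}$ and the following 4-cycles ($1\le i<m$, $1\le j<n$): $(i,j),(i,j+1),(i+1,j+1),(i+1,j)$; $(i,n),(m+1-i,1),(m-i,1),(i+1,n)$; and $(m,j),(1,n+1-j),(1,n-j),(m,j+1)$. A *$C_4$-face-magic projective labeling* on $\mathcal P_{m,n}$ with value $S$ is a bijection $(i,j)\mapsto x_{i,j}$ from the vertices onto $\{1,\dots,mn\}$ such that the labels around each 4-cycle face sum to $S$. It is *bicentrally balanced* if $S=2mn+3$ and, for all vertices $(i,j)$, $x_{i,j}+x_{m+1-i,n+1-j}$ equals $\frac12mn+\frac32$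 if $i+j$ is even and $\frac32mn+\frac32$ if $i+j$ is odd. With $m_0^+=\frac{m+1}2$ and $n_0^+=\frac{n+1}2$, it is moreover *standard* if, for $1\le i\le m-2$, $x_{i,n_0^+}<x_{i+2,n_0^+}$ when $i+n_0^+$ is even and $x_{i,n_0^+}>x_{i+2,n_0^+}$ when $i+n_0^+$ is odd, and, for $1\le j\le n-2$, $x_{m_0^+,j}<x_{m_0^+,j+2}$ when $m_0^++j$ is even and $x_{m_0^+,j}>x_{m_0^+,j+2}$ when $m_0^++j$ is odd. An *$(m,n)$-projective factorization sequence* is a sequence of pairs $F=((m_1,n_1),\dots,(m_k,n_k))$, $k\ge1$, with $m=m_1\cdots m_k$, $n=n_1\cdots n_k$ and all entries greater than $1$, except that $n_k=1$ is also allowed when $k\ge 2$. **Base labelings.** Let $a,b\ge3$ be odd, $a_0=\frac{a-1}2$, $a_0^+=\frac{a+1}2$, $b_0=\frac{b-1}2$, $b_0^+=\frac{b+1}2$. The labeling $x=\mathrm{HALL}(a,b)$ of the $a\times b$ grid $\{1,\dots,a\}\times\{1,\dots,b\}$ is - $x_{2i-1,2j-1}=a(j-1)+i$ for $1\le i\le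 a_0^+$, $1\le j\le b_0^+$; - $x_{2i,2j}=a(j-1)+a_0^++i$ for $1\le i\le a_0$, $1\le j\le b_0$; - $x_{2i,2j-1}=mn+a(1-j)+1-i$ for $1\le i\le a_0$, $1\le j\le b_0^+$; - $x_{2i-1,2j}=mn-aj+a_0^++1-i$ for $1\le i\le a_0^+$, $1\le j\le b_0$. In the same ranges of $i$ and $j$, $y=\mathrm{VALL}(a,b)$ is $y_{2i-1,2j-1}=b(i-1)+j$, $y_{2i,2j}=b(i-1)+b_0^++j$, $y_{2i,2j-1}=mn-bi+b_0^++1-j$, $y_{2i-1,2j}=mn+b(1-i)+1-j$. **Alternating connected sums.** Let $X=(x_{i,j})$ be a labeling of the $a\times b$ grid ($a,b$ odd) and let $r=2r_0+1$ be an odd positive integer. The $r$-horizontal alternating connected sum $\mathrm{HASC}^r(X)=(y_{i,j})$ is the labeling of the $ar\times b$ grid given, for $1\le i\le a$ and $1\le j\le b$, by - $y_{(2k-1)a+i,j}=mn-x_{i,j}+\varepsilon(k-\frac12)ab+\frac32$ for $1\le k\le r_0$, - $y_{2ka+i,j}=x_{i,j}-\varepsilon kab$ for $0\le k\le r_0$,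 where $\varepsilon=1$ if $i+j$ is odd and $\varepsilon=-1$ if $i+j$ is even. The $r$-vertical alternating connected sum $\mathrm{VASC}^r(X)$ is the labeling of the $a\times br$ grid given by the same right-hand sides for $y_{i,(2k-1)b+j}$ and $y_{i,2kb+j}$. **Constructions.** For an $(m,n)$-projective factorization sequence $F=((m_i,n_i))_{i=1}^k$ let $X_1=\mathrm{HALL}(m_1,n_1)$, let $X_i=\mathrm{VASC}^{n_i}(\mathrm{HASC}^{m_i}(X_{i-1}))$ for $2\le i\le k$, and let $\mathrm{HBBL}(F)=X_k$. For an $(n,m)$-projective factorization sequence $F'=((n'_i,m'_i))_{i=1}^{k}$ let $X'_1=\mathrm{VALL}(m'_1,n'_1)$, let $X'_i=\mathrm{HASC}^{m'_i}(\mathrm{VASC}^{n'_i}(X'_{i-1}))$ for $2\le i\le k$, and let $\mathrm{VBBL}(F')=X'_k$. **Theorem.** Let $m,n\ge3$ be odd integers. 1. For every $(m,n)$-projective factorization sequence $F$, $\mathrm{HBBL}(F)$ is a standard bicentrally balanced $C_4$-face-magic projective labeling on $\mathcal P_{m,n}$. 2. For every $(n,m)$-projective factorization sequence $F'$, $\mathrm{VBBL}(F')$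 is a standard bicentrally balanced $C_4$-face-magic projective labeling on $\mathcal P_{m,n}$. 3. If $F_1\ne F_2$ are $(m,n)$-projective factorization sequences, then $\mathrm{HBBL}(F_1)\ne\mathrm{HBBL}(F_2)$ as labelings on $\mathcal P_{m,n}$. 4. If $F_1'\ne F_2'$ are $(n,m)$-projective factorization sequences, then $\mathrm{VBBL}(F_1')\ne\mathrm{VBBL}(F_2')$ as labelings on $\mathcal P_{m,n}$. -/

import Mathlib

/-! Vertices and faces of the projective grid graph. -/

/-- The vertex set of the `m × n` projective grid graph, `{(i, j) : 1 ≤ i ≤ m, 1 ≤ j ≤ n}`. -/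
def projGridVertices (m n : ℕ) : Set (ℕ × ℕ) :=
  {v | 1 ≤ v.1 ∧ v.1 ≤ m ∧ 1 ≤ v.2 ∧ v.2 ≤ n}

/-- The faces of the `m × n` projective grid graph in its natural embedding in the projective
plane, each given by the list of the vertices along its boundary. The edges of the graph join
`(i, j)` to `(i, j + 1)`, `(i, j)` to `(i + 1, j)`, `(i, n)` to `(m + 1 - i, 1)` and `(m, j)` to
`(1, n + 1 - j)`. There are `(m - 1) (n - 1)` inner faces, `m - 1` and `n - 1` faces that cross
the two pairs of identified sides, and the two digons at the corners. -/
inductive IsProjGridFace (m n : ℕ) : List (ℕ × ℕ) → Prop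
  | inner (i j : ℕ) (hi : 1 ≤ i) (hi' : i < m) (hj : 1 ≤ j) (hj' : j < n) :
      IsProjGridFace m n [(i, j), (i, j + 1), (i + 1, j + 1), (i + 1, j)]
  | crossTop (i : ℕ) (hi : 1 ≤ i) (hi' : i < m) :
      IsProjGridFace m n [(i, n), (m + 1 - i, 1), (m - i, 1), (i + 1, n)]
  | crossRight (j : ℕ) (hj : 1 ≤ j) (hj' : j < n) :
      IsProjGridFace m n [(m, j), (1, n + 1 - j), (1, n - j), (m, j + 1)]
  | digonOne : IsProjGridFace m n [(1, 1), (m, n)]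
  | digonTwo : IsProjGridFace m n [(m, 1), (1, n)]

/-! Labelings. -/

/-- A labeling of the grid `{(i, j) : 1 ≤ i ≤ width, 1 ≤ j ≤ height}` by integers. Only the
values of `label` at the points of this grid are relevant. -/
structure GridLabeling where
  width : ℕ
  height : ℕ
  label : ℕ × ℕ → ℤ

/-- `X` is a `C₄`-face-magic projective labeling on the `m × n` projective grid graph with
`C₄`-face-magic value `S`: it labels the vertices bijectively by `1, …, m n`, and the sum of the
labels around every face that is a 4-cycle equals `S`. -/
structure IsC4FaceMagicLabeling (m n : ℕ) (S : ℤ) (X : GridLabeling) : Prop where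
  width_eq : X.width = m
  height_eq : X.height = n
  bijOn : Set.BijOn X.label (projGridVertices m n) (Set.Icc 1 ((m : ℤ) * n))
  face_sum : ∀ f : List (ℕ × ℕ), IsProjGridFace m n f → f.length = 4 → (f.map X.label).sum = S

/-- A `C₄`-face-magic projective labeling is bicentrally balanced if its value is `2 m n + 3` and
`x (i, j) + x (m + 1 - i, n + 1 - j)` is `m n / 2 + 3 / 2` when `i + j` is even and
`3 m n / 2 + 3 / 2` when `i + j` is odd (the equation is multiplied by `2` here). -/
structure IsBicentrallyBalanced (m n : ℕ) (X : GridLabeling) : Prop where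
  magic : IsC4FaceMagicLabeling m n (2 * m * n + 3) X
  balanced : ∀ i j : ℕ, (i, j) ∈ projGridVertices m n →
    2 * (X.label (i, j) + X.label (m + 1 - i, n + 1 - j)) =
      if Even (i + j) then (m : ℤ) * n + 3 else 3 * ((m : ℤ) * n) + 3

/-- Standard bicentrally balanced labelings (`m` and `n` odd): the labels in the central row
`j = (n + 1) / 2` and in the central column `i = (m + 1) / 2` increase in steps of two at the
vertices with even coordinate sum, and decrease in steps of two at those with odd coordinate
sum. -/
structure IsStandardBicentrallyBalanced (m n : ℕ) (X : GridLabeling) : Prop where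
  balanced : IsBicentrallyBalanced m n X
  row_even : ∀ i : ℕ, 1 ≤ i → i + 2 ≤ m → Even (i + (n + 1) / 2) →
    X.label (i, (n + 1) / 2) < X.label (i + 2, (n + 1) / 2)
  row_odd : ∀ i : ℕ, 1 ≤ i → i + 2 ≤ m → Odd (i + (n + 1) / 2) →
    X.label (i + 2, (n + 1) / 2) < X.label (i, (n + 1) / 2)
  col_even : ∀ j : ℕ, 1 ≤ j → j + 2 ≤ n → Even ((m + 1) / 2 + j) →
    X.label ((m + 1) / 2, j) < X.label ((m + 1) / 2, j + 2)
  col_odd : ∀ j : ℕ, 1 ≤ j → j + 2 ≤ n → Odd ((m + 1) / 2 + j) →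
    X.label ((m + 1) / 2, j + 2) < X.label ((m + 1) / 2, j)

/-! Alternating lexicographic labelings. -/

/-- The partial horizontal alternating lexicographic labeling on the `m × n` subgrid of the
`M × N` projective grid graph (`m`, `n` odd). At `v = (2 i - 1 or 2 i, 2 j - 1 or 2 j)` the
variables `i` and `j` below have these values. -/
def HALL (M N m n : ℕ) : GridLabeling where
  width := m
  height := n
  label v :=
    let i : ℤ := ((v.1 + 1) / 2 : ℕ)
    let j : ℤ := ((v.2 + 1) / 2 : ℕ)
    let m₀' : ℤ := ((m + 1) / 2 : ℕ)
    if Odd v.1 then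
      if Odd v.2 then m * (j - 1) + i
      else M * N - m * j + m₀' + 1 - i
    else
      if Odd v.2 then M * N + m * (1 - j) + 1 - i
      else m * (j - 1) + m₀' + i

/-- The partial vertical alternating lexicographic labeling on the `m × n` subgrid of the
`M × N` projective grid graph (`m`, `n` odd), with `i` and `j` as in `HALL`. -/
def VALL (M N m n : ℕ) : GridLabeling where
  width := m
  height := n
  label v :=
    let i : ℤ := ((v.1 + 1) / 2 : ℕ)
    let j : ℤ := ((v.2 + 1) / 2 : ℕ)
    let n₀' : ℤ := ((n + 1) / 2 : ℕ)
    if Odd v.1 then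
      if Odd v.2 then n * (i - 1) + j
      else M * N + n * (1 - i) + 1 - j
    else
      if Odd v.2 then M * N - n * i + n₀' + 1 - j
      else n * (i - 1) + n₀' + j

/-! Alternating connected sums. -/

/-- The label which the `q`-th block (counted from `0`) of an alternating connected sum of a
labeling of an `m × n` grid carries at a vertex that has the position `(i, j)` in its block, where
`x` is the label of `(i, j)` in the labeling that is summed.
* If `q = 2 k - 1`, it is `M N - x + (k - 1 / 2) m n + 3 / 2` for `i + j` odd and
  `M N - x - (k - 1 / 2) m n + 3 / 2` for `i + j` even.
* If `q = 2 k`, it is `x - k m n` for `i + j` odd and `x + k m n` for `i + j` even.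

The integer divisions by `2` are exact as `m` and `n` are odd. -/
def alternatingLabel (M N m n q i j : ℕ) (x : ℤ) : ℤ :=
  let k : ℤ := ((q + 1) / 2 : ℕ)
  if Odd q then
    if Odd (i + j) then M * N - x + ((2 * k - 1) * (m * n) + 3) / 2
    else M * N - x + (-((2 * k - 1) * (m * n)) + 3) / 2
  else
    if Odd (i + j) then x - k * (m * n)
    else x + k * (m * n)

/-- The `r`-horizontal alternating connected sum inside the `M × N` projective grid graph. The
vertex `(q m + i, j)` with `1 ≤ i ≤ m` has the position `(i, j)` in block `q`. -/
def HASC (M N r : ℕ) (X : GridLabeling) : GridLabeling where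
  width := X.width * r
  height := X.height
  label v :=
    let q := (v.1 - 1) / X.width
    let i := (v.1 - 1) % X.width + 1
    alternatingLabel M N X.width X.height q i v.2 (X.label (i, v.2))

/-- The `r`-vertical alternating connected sum inside the `M × N` projective grid graph. The
vertex `(i, q n + j)` with `1 ≤ j ≤ n` has the position `(i, j)` in block `q`. -/
def VASC (M N r : ℕ) (X : GridLabeling) : GridLabeling where
  width := X.width
  height := X.height * r
  label v :=
    let q := (v.2 - 1) / X.height
    let j := (v.2 - 1) % X.height + 1
    alternatingLabel M N X.width X.height q v.1 j (X.label (v.1, j))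

/-! Projective factorization sequences and the labelings associated with them. -/

/-- `(m, n)`-projective factorization sequences, as lists of pairs `(m₁, n₁), …, (mₖ, nₖ)` with
`m = m₁ ⋯ mₖ` and `n = n₁ ⋯ nₖ`. In a sequence of even length all entries are greater than `1`.
A sequence of odd length `(m₁, n₁, …, mₖ, nₖ, mₖ₊₁)`, where `k ≥ 1`, is represented with
`nₖ₊₁ = 1` appended. -/
def IsProjFactorizationSeq (m n : ℕ) (F : List (ℕ × ℕ)) : Prop :=
  (F.map Prod.fst).prod = m ∧ (F.map Prod.snd).prod = n ∧
    ((F ≠ [] ∧ ∀ p ∈ F, 1 < p.1 ∧ 1 < p.2) ∨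
      ∃ (G : List (ℕ × ℕ)) (a : ℕ), G ≠ [] ∧ (∀ p ∈ G, 1 < p.1 ∧ 1 < p.2) ∧ 1 < a ∧
        F = G ++ [(a, 1)])

/-- The horizontal bicentrally balanced labeling associated with the sequence
`F = ((m₁, n₁), …, (mₖ, nₖ))`: it is `Xₖ`, where `X₁ = HALL (m₁, n₁)` and `Xᵢ` is the
`nᵢ`-vertical alternating connected sum of the `mᵢ`-horizontal one of `Xᵢ₋₁`. The value at the
empty list, which is no factorization sequence, is irrelevant. -/
def HBBL (m n : ℕ) : List (ℕ × ℕ) → GridLabeling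
  | [] => ⟨0, 0, fun _ => 0⟩
  | p :: F => F.foldl (fun X p => VASC m n p.2 (HASC m n p.1 X)) (HALL m n p.1 p.2)

/-- The vertical bicentrally balanced labeling associated with an `(n, m)`-sequence
`F' = ((n₁, m₁), …, (nₖ, mₖ))`: it is `Xₖ`, where `X₁ = VALL (m₁, n₁)` and `Xᵢ` is the
`mᵢ`-horizontal alternating connected sum of the `nᵢ`-vertical one of `Xᵢ₋₁`. The value at the
empty list, which is no factorization sequence, is irrelevant. -/
def VBBL (m n : ℕ) : List (ℕ × ℕ) → GridLabeling
  | [] => ⟨0, 0, fun _ => 0⟩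
  | p :: F => F.foldl (fun X p => HASC m n p.2 (VASC m n p.1 X)) (VALL m n p.2 p.1)

/-!
All the labelings list `1, m n, 2, m n - 1, …` in the order of an index `f i + g j` that depends
separately on the two coordinates: a horizontal sum changes only `f`, a vertical one only `g`.
The index has the parity of `i + j` and is reversed by the half-turn of the grid, so the sum of a
label and its image under the half-turn depends only on the parity. A face across the boundary
consists of two half-turn pairs of different parities. On an inner face the labels of one parity
increase and those of the other decrease with the index, and as `f i + g j` is separable the index
cancels from their sum.

A factorization sequence is recovered from its labeling one entry at a time, because the first
label outside the first block of an alternating connected sum reveals the area of that block.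
-/

/-- The `t`-th term of the sequence `1, K, 2, K - 1, 3, …`, with `t` counted from `0`. It lists
`1, …, K` when it is stopped after `K` terms. -/
def zigzag (K : ℤ) (t : ℕ) : ℤ :=
  if Even t then (t / 2 : ℕ) + 1 else K - (t / 2 : ℕ)

lemma two_mul_zigzag_of_even (K : ℤ) {t : ℕ} (ht : Even t) : 2 * zigzag K t = t + 2 := by
  rw [zigzag, if_pos ht]
  rw [Nat.even_iff] at ht
  omega

lemma two_mul_zigzag_of_not_even (K : ℤ) {t : ℕ} (ht : ¬ Even t) :
    2 * zigzag K t = 2 * K - t + 1 := by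
  rw [zigzag, if_neg ht]
  rw [Nat.even_iff] at ht
  omega

lemma mapsTo_zigzag (K : ℤ) : Set.MapsTo (zigzag K) {t | (t : ℤ) < K} (Set.Icc 1 K) := by
  intro t (ht : (t : ℤ) < K)
  rw [Set.mem_Icc, zigzag]
  split_ifs <;> omega

lemma injOn_zigzag (K : ℤ) : Set.InjOn (zigzag K) {t | (t : ℤ) < K} := by
  intro s (hs : (s : ℤ) < K) t (ht : (t : ℤ) < K) h
  simp only [zigzag, Nat.even_iff] at h
  split_ifs at h <;> omega

lemma alternatingLabel_zigzag (M N : ℕ) {m n q i j t : ℕ} (hm : Odd m) (hn : Odd n)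
    (ht : Even t ↔ Even (i + j)) :
    alternatingLabel M N m n q i j (zigzag (M * N) t) = zigzag (M * N) (t + q * (m * n)) := by
  have parity : Even (t + q * (m * n)) ↔ (Even t ↔ Even q) := by
    simp only [Nat.even_add, Nat.even_mul, Nat.not_even_iff_odd.2 hm, Nat.not_even_iff_odd.2 hn,
      or_false]
  simp only [alternatingLabel, zigzag, parity, ← Nat.not_even_iff_odd, ← ht]
  obtain ⟨k, rfl | rfl⟩ := Nat.even_or_odd' q
  · have shift : 2 * k * (m * n) = 2 * (k * (m * n)) := by ring
    have half : (2 * k + 1) / 2 = k := by omega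
    rw [shift, half, ← Nat.cast_mul m n, ← Nat.cast_mul k]
    by_cases he : Even t <;>
      simp only [he, even_two_mul, not_true, not_false_iff, if_true, if_false, iff_true] <;> omega
  · obtain ⟨s, hs⟩ : Odd ((2 * k + 1) * (m * n)) := (odd_two_mul_add_one k).mul (hm.mul hn)
    have half : 2 * (((2 * k + 1 + 1) / 2 : ℕ) : ℤ) - 1 = (2 * k + 1 : ℕ) := by omega
    rw [half, ← Nat.cast_mul m n, ← Nat.cast_mul, hs]
    have odd : ¬ Even (2 * k + 1) := Nat.not_even_two_mul_add_one k
    by_cases he : Even t <;> have he' := he <;> rw [Nat.even_iff] at he' <;>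
      simp only [he, odd, not_true, not_false_iff, if_true, if_false, iff_false] <;> omega

/-- The functions `f` and `g` index the `m × n` grid, with coordinates counted from `0`, by
`f i + g j`. The index increases along rows and columns, has the parity of `i + j`, takes the
values `0, …, m n - 1` once each, and is reversed by the half-turn of the grid. Monotonicity and
parity are also imposed beyond the grid, which spares range conditions. -/
structure IsGridIndex (m n : ℕ) (f g : ℕ → ℕ) : Prop where
  strictMono_left : StrictMono f
  strictMono_right : StrictMono g
  even_left : ∀ i, Even (f i) ↔ Even i
  even_right : ∀ j, Even (g j) ↔ Even j
  halfTurn : ∀ i j i' j', i + i' + 1 = m → j + j' + 1 = n →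
    f i + g j + (f i' + g j') + 1 = m * n
  inj : ∀ i j i' j', i < m → j < n → i' < m → j' < n →
    f i + g j = f i' + g j' → i = i' ∧ j = j'

lemma mod_add_mod_and_div_add_div_of_add_eq {m r i i' : ℕ} (h : i + i' + 1 = m * r) :
    i % m + i' % m + 1 = m ∧ i / m + i' / m + 1 = r := by
  have lt : i < m * r := by omega
  have hi' : i' = m * r - (i + 1) := by omega
  have hm := Nat.mod_lt i (Nat.pos_of_mul_pos_right (by omega : 0 < m * r))
  have hr := Nat.div_lt_of_lt_mul lt
  rw [hi', Nat.mul_sub_mod lt, Nat.mul_sub_div _ _ _ lt]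
  omega

namespace IsGridIndex

variable {m n : ℕ} {f g : ℕ → ℕ}

lemma swap (h : IsGridIndex m n f g) : IsGridIndex n m g f where
  strictMono_left := h.strictMono_right
  strictMono_right := h.strictMono_left
  even_left := h.even_right
  even_right := h.even_left
  halfTurn i j i' j' hi hj := by
    rw [mul_comm n m, ← h.halfTurn j i j' i' hj hi, add_comm (g i), add_comm (g i')]
  inj i j i' j' hi hj hi' hj' e :=
    (h.inj j i j' i' hj hi hj' hi' (by rwa [add_comm, add_comm (f j')])).symm

lemma even_add (h : IsGridIndex m n f g) (i j : ℕ) : Even (f i + g j) ↔ Even (i + j) := by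
  rw [Nat.even_add, Nat.even_add, h.even_left, h.even_right]

lemma lt_mul (h : IsGridIndex m n f g) {i j : ℕ} (hi : i < m) (hj : j < n) :
    f i + g j < m * n := by
  have := h.halfTurn i j (m - 1 - i) (n - 1 - j) (by omega) (by omega)
  omega

lemma lexicographic {m n : ℕ} (hm : Odd m) : IsGridIndex m n id (m * ·) where
  strictMono_left := strictMono_id
  strictMono_right _ _ hj := Nat.mul_lt_mul_of_pos_left hj hm.pos
  even_left _ := Iff.rfl
  even_right j := by simp only [Nat.even_mul, Nat.not_even_iff_odd.2 hm, false_or]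
  halfTurn i j i' j' hi hj := by
    rw [← hj, mul_add, mul_add, mul_one, id, id]
    omega
  inj i j i' j' hi _ hi' _ e := by
    have hii' : i = i' := by
      simpa [Nat.mod_eq_of_lt hi, Nat.mod_eq_of_lt hi'] using congrArg (· % m) e
    subst hii'
    exact ⟨rfl, Nat.eq_of_mul_eq_mul_left hm.pos (Nat.add_left_cancel e)⟩

lemma repeat_left (h : IsGridIndex m n f g) (hm : Odd m) (hn : Odd n) (r : ℕ) :
    IsGridIndex (m * r) n (fun i => f (i % m) + i / m * (m * n)) g where
  strictMono_left i i' hi := by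
    dsimp only
    rcases (Nat.div_le_div_right hi.le : i / m ≤ i' / m).lt_or_eq with hq | hq
    · have hf := h.lt_mul (Nat.mod_lt i hm.pos) hn.pos
      have := Nat.mul_le_mul_right (m * n) (Nat.succ_le_of_lt hq)
      rw [Nat.succ_mul] at this
      omega
    · have hmod : i % m < i' % m := by
        have hi_eq := Nat.div_add_mod i m
        have hi'_eq := Nat.div_add_mod i' m
        rw [hq] at hi_eq
        omega
      rw [hq]
      exact Nat.add_lt_add_right (h.strictMono_left hmod) _
  strictMono_right := h.strictMono_right
  even_left i := by
    have hi : Even (m * (i / m) + i % m) ↔ Even i := by rw [Nat.div_add_mod]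
    rw [← hi]
    simp only [Nat.even_add, Nat.even_mul, h.even_left, Nat.not_even_iff_odd.2 hm,
      Nat.not_even_iff_odd.2 hn, or_false, false_or, iff_comm]
  even_right := h.even_right
  halfTurn i j i' j' hi hj := by
    obtain ⟨hmod, hdiv⟩ := mod_add_mod_and_div_add_div_of_add_eq hi
    rw [← hdiv, mul_right_comm, mul_comm (m * n), add_mul, add_mul, one_mul,
      ← h.halfTurn _ j _ j' hmod hj]
    ring
  inj i j i' j' _ hj _ hj' e := by
    have lt := h.lt_mul (Nat.mod_lt i hm.pos) hj
    have lt' := h.lt_mul (Nat.mod_lt i' hm.pos) hj'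
    rw [add_right_comm, add_right_comm (f (i' % m))] at e
    have hidx : f (i % m) + g j = f (i' % m) + g j' := by
      simpa [Nat.mod_eq_of_lt lt, Nat.mod_eq_of_lt lt'] using congrArg (· % (m * n)) e
    rw [hidx] at e
    have hdiv := Nat.eq_of_mul_eq_mul_right (Nat.mul_pos hm.pos hn.pos) (Nat.add_left_cancel e)
    obtain ⟨hmod, hjj'⟩ := h.inj _ _ _ _ (Nat.mod_lt i hm.pos) hj (Nat.mod_lt i' hm.pos) hj' hidx
    exact ⟨by rw [← Nat.div_add_mod i m, hmod, hdiv, Nat.div_add_mod], hjj'⟩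

end IsGridIndex

/-- The labeling obtained by interchanging the coordinates. -/
def GridLabeling.transpose (X : GridLabeling) : GridLabeling :=
  ⟨X.height, X.width, fun v => X.label v.swap⟩

lemma alternatingLabel_swap (M N m n q i j : ℕ) (x : ℤ) :
    alternatingLabel M N m n q i j x = alternatingLabel N M n m q j i x := by
  simp only [alternatingLabel, add_comm i j, mul_comm (m : ℤ) n, mul_comm (M : ℤ) N]

lemma vasc_transpose (M N r : ℕ) (X : GridLabeling) :
    VASC M N r X.transpose = (HASC N M r X).transpose := by
  simp only [HASC, VASC, GridLabeling.transpose, alternatingLabel_swap M N, Prod.swap_prod_mk,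
    Prod.fst_swap, Prod.snd_swap]

lemma hasc_transpose (M N r : ℕ) (X : GridLabeling) :
    HASC M N r X.transpose = (VASC N M r X).transpose :=
  congrArg GridLabeling.transpose (vasc_transpose N M r X.transpose).symm

lemma vall_eq_transpose (M N m n : ℕ) : VALL M N m n = (HALL N M n m).transpose := by
  simp only [VALL, HALL, GridLabeling.transpose, mul_comm (M : ℤ) N, Prod.fst_swap, Prod.snd_swap,
    GridLabeling.mk.injEq, true_and]
  funext v
  split_ifs <;> rfl

lemma vbbl_eq_transpose (m n : ℕ) (F : List (ℕ × ℕ)) : VBBL m n F = (HBBL n m F).transpose := by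
  rcases F with - | ⟨p, F⟩
  · rfl
  · simp only [VBBL, HBBL, vall_eq_transpose]
    generalize HALL n m p.1 p.2 = X
    induction F generalizing X with
    | nil => rfl
    | cons p F ih => rw [List.foldl_cons, List.foldl_cons, vasc_transpose, hasc_transpose, ih]

/-- `X` labels a grid with odd sides by the sequence `1, K, 2, K - 1, …`, in the order given by
the index `f i + g j`. -/
structure IsZigzag (K : ℤ) (X : GridLabeling) (f g : ℕ → ℕ) : Prop where
  odd_width : Odd X.width
  odd_height : Odd X.height
  index : IsGridIndex X.width X.height f g
  label_succ : ∀ i j, X.label (i + 1, j + 1) = zigzag K (f i + g j)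

namespace IsZigzag

variable {K : ℤ} {X : GridLabeling} {f g : ℕ → ℕ}

lemma transpose (h : IsZigzag K X f g) : IsZigzag K X.transpose g f where
  odd_width := h.odd_height
  odd_height := h.odd_width
  index := h.index.swap
  label_succ i j := by rw [add_comm (g i), ← h.label_succ]; rfl

lemma hall (M N : ℕ) {m n : ℕ} (hm : Odd m) (hn : Odd n) :
    IsZigzag (M * N) (HALL M N m n) id (m * ·) where
  odd_width := hm
  odd_height := hn
  index := .lexicographic hm
  label_succ i j := by
    have even_index : Even (id i + m * j) ↔ (Even i ↔ Even j) := by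
      rw [(IsGridIndex.lexicographic (n := n) hm).even_add, Nat.even_add]
    have half₁ (k : ℕ) : (2 * k + 1 + 1) / 2 = k + 1 := by omega
    have half₂ (k : ℕ) : (2 * k + 1 + 1 + 1) / 2 = k + 1 := by omega
    obtain ⟨a, rfl⟩ := hm
    apply mul_left_cancel₀ (two_ne_zero' ℤ)
    obtain ⟨k, rfl | rfl⟩ := Nat.even_or_odd' i <;> obtain ⟨l, rfl | rfl⟩ := Nat.even_or_odd' j <;>
      [rw [two_mul_zigzag_of_even _ (even_index.2 (by simp))];
        rw [two_mul_zigzag_of_not_even _ (mt even_index.1 (by simp))];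
        rw [two_mul_zigzag_of_not_even _ (mt even_index.1 (by simp))];
        rw [two_mul_zigzag_of_even _ (even_index.2 (by simp))]] <;>
      simp only [HALL, half₁, half₂, Nat.odd_add_one, odd_two_mul_add_one, not_true, if_true,
        if_false, id] <;>
      push_cast <;> ring

lemma hasc {M N : ℕ} (h : IsZigzag (M * N) X f g) {r : ℕ} (hr : Odd r) :
    IsZigzag (M * N) (HASC M N r X)
      (fun i => f (i % X.width) + i / X.width * (X.width * X.height)) g where
  odd_width := h.odd_width.mul hr
  odd_height := h.odd_height
  index := h.index.repeat_left h.odd_width h.odd_height r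
  label_succ i j := by
    have parity : Even (f (i % X.width) + g j) ↔ Even (i % X.width + 1 + (j + 1)) := by
      rw [h.index.even_add, Nat.even_iff, Nat.even_iff]
      omega
    rw [add_right_comm, ← alternatingLabel_zigzag M N h.odd_width h.odd_height parity,
      ← h.label_succ]
    rfl

lemma vasc {M N : ℕ} (h : IsZigzag (M * N) X f g) {r : ℕ} (hr : Odd r) :
    IsZigzag (M * N) (VASC M N r X) f
      (fun j => g (j % X.height) + j / X.height * (X.height * X.width)) := by
  rw [mul_comm (M : ℤ)] at h ⊢
  rw [show VASC M N r X = (HASC N M r X.transpose).transpose from vasc_transpose M N r X.transpose]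
  exact (h.transpose.hasc hr).transpose

lemma exists_hbbl (M N : ℕ) {F : List (ℕ × ℕ)} (hF : F ≠ [])
    (hodd : ∀ p ∈ F, Odd p.1 ∧ Odd p.2) :
    ∃ f g, IsZigzag (M * N) (HBBL M N F) f g := by
  obtain ⟨p, F, rfl⟩ := List.exists_cons_of_ne_nil hF
  rw [List.forall_mem_cons] at hodd
  refine List.foldlRecOn (motive := fun X => ∃ f g, IsZigzag (M * N) X f g) F _
    ⟨_, _, hall M N hodd.1.1 hodd.1.2⟩ ?_
  rintro X ⟨f, g, hX⟩ p hp
  exact ⟨_, _, (hX.hasc (hodd.2 p hp).1).vasc (hodd.2 p hp).2⟩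

lemma label_eq (h : IsZigzag K X f g) {i j : ℕ} (hi : 1 ≤ i) (hj : 1 ≤ j) :
    X.label (i, j) = zigzag K (f (i - 1) + g (j - 1)) := by
  rw [← h.label_succ, Nat.sub_add_cancel hi, Nat.sub_add_cancel hj]

lemma even_index (h : IsZigzag K X f g) {i j : ℕ} (hi : 1 ≤ i) (hj : 1 ≤ j) :
    Even (f (i - 1) + g (j - 1)) ↔ Even (i + j) := by
  rw [h.index.even_add, Nat.even_iff, Nat.even_iff]
  omega

lemma two_mul_label_of_even (h : IsZigzag K X f g) {i j : ℕ} (hi : 1 ≤ i) (hj : 1 ≤ j)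
    (he : Even (i + j)) : 2 * X.label (i, j) = f (i - 1) + g (j - 1) + 2 := by
  rw [h.label_eq hi hj, two_mul_zigzag_of_even K ((h.even_index hi hj).2 he), Nat.cast_add]

lemma two_mul_label_of_not_even (h : IsZigzag K X f g) {i j : ℕ} (hi : 1 ≤ i) (hj : 1 ≤ j)
    (he : ¬ Even (i + j)) :
    2 * X.label (i, j) = 2 * K - (f (i - 1) + g (j - 1)) + 1 := by
  rw [h.label_eq hi hj, two_mul_zigzag_of_not_even K (mt (h.even_index hi hj).1 he), Nat.cast_add]

lemma injOn_label (h : IsZigzag (X.width * X.height) X f g) :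
    Set.InjOn X.label (projGridVertices X.width X.height) := by
  rintro ⟨i, j⟩ ⟨hi, hi', hj, hj'⟩ ⟨k, l⟩ ⟨hk, hk', hl, hl'⟩ e
  dsimp only at *
  rw [h.label_eq hi hj, h.label_eq hk hl] at e
  have hidx := injOn_zigzag _ (by exact_mod_cast h.index.lt_mul (by omega) (by omega))
    (by exact_mod_cast h.index.lt_mul (by omega) (by omega)) e
  have := h.index.inj _ _ _ _ (by omega) (by omega) (by omega) (by omega) hidx
  rw [Prod.mk.injEq]
  omega

lemma mapsTo_label (h : IsZigzag (X.width * X.height) X f g) :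
    Set.MapsTo X.label (projGridVertices X.width X.height)
      (Set.Icc 1 ((X.width : ℤ) * X.height)) := by
  rintro ⟨i, j⟩ ⟨hi, hi', hj, hj'⟩
  dsimp only at *
  rw [h.label_eq hi hj]
  exact mapsTo_zigzag _ (by exact_mod_cast h.index.lt_mul (by omega) (by omega))

lemma bijOn_label (h : IsZigzag (X.width * X.height) X f g) :
    Set.BijOn X.label (projGridVertices X.width X.height)
      (Set.Icc 1 ((X.width : ℤ) * X.height)) := by
  have maps := h.mapsTo_label
  have inj := h.injOn_label
  have domain : projGridVertices X.width X.height =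
      ↑(Finset.Icc 1 X.width ×ˢ Finset.Icc 1 X.height) := by
    ext ⟨i, j⟩
    simp only [projGridVertices, Set.mem_ofPred_eq, Finset.coe_product, Finset.coe_Icc,
      Set.mem_prod, Set.mem_Icc, and_assoc]
  rw [domain, ← Finset.coe_Icc] at maps ⊢
  rw [domain] at inj
  refine ⟨maps, inj, Finset.surjOn_of_injOn_of_card_le _ maps inj ?_⟩
  simp only [Int.card_Icc, Finset.card_product, Nat.card_Icc, Nat.add_sub_cancel,
    add_sub_cancel_right]
  exact_mod_cast (Int.toNat_natCast (X.width * X.height)).le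

lemma label_add_label_halfTurn (h : IsZigzag (X.width * X.height) X f g) {i j i' j' : ℕ}
    (hi : 1 ≤ i) (hj : 1 ≤ j) (hi' : 1 ≤ i') (hj' : 1 ≤ j') (hii' : i + i' = X.width + 1)
    (hjj' : j + j' = X.height + 1) :
    2 * (X.label (i, j) + X.label (i', j')) =
      if Even (i + j) then (X.width : ℤ) * X.height + 3
      else 3 * ((X.width : ℤ) * X.height) + 3 := by
  have index_sum := h.index.halfTurn (i - 1) (j - 1) (i' - 1) (j' - 1) (by omega) (by omega)
  zify at index_sum
  have parity : Even (i' + j') ↔ Even (i + j) := by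
    have hw := Nat.odd_iff.1 h.odd_width
    have hh := Nat.odd_iff.1 h.odd_height
    rw [Nat.even_iff, Nat.even_iff]
    omega
  split_ifs with he
  · linarith [h.two_mul_label_of_even hi hj he,
      h.two_mul_label_of_even hi' hj' (parity.2 he)]
  · linarith [h.two_mul_label_of_not_even hi hj he,
      h.two_mul_label_of_not_even hi' hj' (mt parity.1 he)]

lemma sum_inner_face (h : IsZigzag K X f g) {i j : ℕ} (hi : 1 ≤ i) (hj : 1 ≤ j) :
    X.label (i, j) + X.label (i, j + 1) + X.label (i + 1, j + 1) + X.label (i + 1, j) =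
      2 * K + 3 := by
  have hi' : 1 ≤ i + 1 := by omega
  have hj' : 1 ≤ j + 1 := by omega
  by_cases he : Even (i + j)
  · linarith [h.two_mul_label_of_even hi hj he,
      h.two_mul_label_of_even hi' hj' (by grind),
      h.two_mul_label_of_not_even hi hj' (by grind),
      h.two_mul_label_of_not_even hi' hj (by grind)]
  · linarith [h.two_mul_label_of_not_even hi hj he,
      h.two_mul_label_of_not_even hi' hj' (by grind),
      h.two_mul_label_of_even hi hj' (by grind),
      h.two_mul_label_of_even hi' hj (by grind)]

lemma sum_crossTop_face (h : IsZigzag (X.width * X.height) X f g) {i : ℕ} (hi : 1 ≤ i)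
    (hi' : i < X.width) :
    X.label (i, X.height) + X.label (X.width + 1 - i, 1) + X.label (X.width - i, 1) +
      X.label (i + 1, X.height) = 2 * X.width * X.height + 3 := by
  have hh : 1 ≤ X.height := h.odd_height.pos
  have pair₁ := h.label_add_label_halfTurn (i' := X.width + 1 - i) hi hh (by omega) le_rfl
    (by omega) rfl
  have pair₂ := h.label_add_label_halfTurn (i := i + 1) (i' := X.width - i) (by omega) hh
    (by omega) le_rfl (by omega) rfl
  simp only [add_right_comm i 1, Nat.even_add_one] at pair₂
  split_ifs at pair₁ pair₂ <;> linarith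

lemma sum_crossRight_face (h : IsZigzag (X.width * X.height) X f g) {j : ℕ} (hj : 1 ≤ j)
    (hj' : j < X.height) :
    X.label (X.width, j) + X.label (1, X.height + 1 - j) + X.label (1, X.height - j) +
      X.label (X.width, j + 1) = 2 * X.width * X.height + 3 := by
  rw [mul_comm (X.width : ℤ)] at h
  rw [mul_right_comm]
  exact sum_crossTop_face (X := X.transpose) h.transpose hj hj'

lemma isBicentrallyBalanced (h : IsZigzag (X.width * X.height) X f g) :
    IsBicentrallyBalanced X.width X.height X where
  magic :=
    { width_eq := rfl
      height_eq := rfl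
      bijOn := h.bijOn_label
      face_sum := by
        rintro _ (⟨i, j, hi, -, hj, -⟩ | ⟨i, hi, hi'⟩ | ⟨j, hj, hj'⟩ | - | -) hlen
        · simpa [add_assoc, mul_assoc] using h.sum_inner_face hi hj
        · simpa [add_assoc] using h.sum_crossTop_face hi hi'
        · simpa [add_assoc] using h.sum_crossRight_face hj hj'
        all_goals simp at hlen }
  balanced := by
    rintro i j ⟨hi, hi', hj, hj'⟩
    dsimp only at *
    exact h.label_add_label_halfTurn hi hj (by omega) (by omega) (by omega) (by omega)

lemma label_lt_label_add_two (h : IsZigzag K X f g) {i j : ℕ} (hi : 1 ≤ i) (hj : 1 ≤ j)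
    (he : Even (i + j)) : X.label (i, j) < X.label (i + 2, j) := by
  have index_lt := h.index.strictMono_left (by omega : i - 1 < i + 2 - 1)
  have label := h.two_mul_label_of_even hi hj he
  have label_add_two := h.two_mul_label_of_even (i := i + 2) (by omega) hj (by grind)
  omega

lemma label_add_two_lt_label (h : IsZigzag K X f g) {i j : ℕ} (hi : 1 ≤ i) (hj : 1 ≤ j)
    (ho : Odd (i + j)) : X.label (i + 2, j) < X.label (i, j) := by
  rw [← Nat.not_even_iff_odd] at ho
  have index_lt := h.index.strictMono_left (by omega : i - 1 < i + 2 - 1)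
  have label := h.two_mul_label_of_not_even hi hj ho
  have label_add_two := h.two_mul_label_of_not_even (i := i + 2) (by omega) hj (by grind)
  omega

lemma isStandardBicentrallyBalanced (h : IsZigzag (X.width * X.height) X f g) :
    IsStandardBicentrallyBalanced X.width X.height X where
  balanced := h.isBicentrallyBalanced
  row_even i hi _ he := h.label_lt_label_add_two hi (by grind [h.odd_height.pos]) he
  row_odd i hi _ ho := h.label_add_two_lt_label hi (by grind [h.odd_height.pos]) ho
  col_even j hj _ he :=
    h.transpose.label_lt_label_add_two hj (by grind [h.odd_width.pos]) (by rwa [add_comm])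
  col_odd j hj _ ho :=
    h.transpose.label_add_two_lt_label hj (by grind [h.odd_width.pos]) (by rwa [add_comm])

end IsZigzag

/-- Equality as labelings: only the labels of the grid points are compared. -/
structure GridLabeling.Agrees (X Y : GridLabeling) : Prop where
  width_eq : X.width = Y.width
  height_eq : X.height = Y.height
  eqOn : Set.EqOn X.label Y.label (projGridVertices X.width X.height)

/-- The tails of projective factorization sequences: all entries exceed `1`, except that the very
last one may be `1`. -/
inductive IsProjFactorizationTail : List (ℕ × ℕ) → Prop
  | nil : IsProjFactorizationTail []
  | last {a : ℕ} (ha : 1 < a) : IsProjFactorizationTail [(a, 1)]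
  | cons {p : ℕ × ℕ} {F : List (ℕ × ℕ)} (h₁ : 1 < p.1) (h₂ : 1 < p.2)
      (hF : IsProjFactorizationTail F) : IsProjFactorizationTail (p :: F)

namespace IsProjFactorizationTail

variable {F G : List (ℕ × ℕ)}

lemma append_left (hF : IsProjFactorizationTail F) (hG : ∀ p ∈ G, 1 < p.1 ∧ 1 < p.2) :
    IsProjFactorizationTail (G ++ F) := by
  induction G with
  | nil => exact hF
  | cons p G ih =>
    rw [List.forall_mem_cons] at hG
    exact .cons hG.1.1 hG.1.2 (ih hG.2)

lemma prod_fst_eq_one_iff (hF : IsProjFactorizationTail F) :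
    (F.map Prod.fst).prod = 1 ↔ F = [] := by
  rcases hF with - | ha | ⟨h₁, -, -⟩ <;>
    simp only [List.map_nil, List.map_cons, List.prod_nil, List.prod_cons, mul_eq_one,
      reduceCtorEq, iff_false] <;> omega

lemma pos (hF : IsProjFactorizationTail F) : ∀ p ∈ F, 0 < p.1 ∧ 0 < p.2 := by
  induction hF with
  | nil => simp
  | last ha => simpa using by omega
  | cons h₁ h₂ _ ih => exact List.forall_mem_cons.2 ⟨⟨by omega, by omega⟩, ih⟩

end IsProjFactorizationTail

namespace IsProjFactorizationSeq

variable {m n : ℕ} {F : List (ℕ × ℕ)}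

lemma exists_cons (h : IsProjFactorizationSeq m n F) :
    ∃ p G, F = p :: G ∧ 1 < p.1 ∧ 1 < p.2 ∧ IsProjFactorizationTail G := by
  rcases h with ⟨-, -, ⟨hne, hF⟩ | ⟨G, a, hne, hG, ha, rfl⟩⟩
  · obtain ⟨p, G, rfl⟩ := List.exists_cons_of_ne_nil hne
    rw [List.forall_mem_cons] at hF
    refine ⟨p, G, rfl, hF.1.1, hF.1.2, ?_⟩
    simpa using IsProjFactorizationTail.nil.append_left hF.2
  · obtain ⟨p, G, rfl⟩ := List.exists_cons_of_ne_nil hne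
    rw [List.forall_mem_cons] at hG
    exact ⟨p, G ++ [(a, 1)], rfl, hG.1.1, hG.1.2,
      (IsProjFactorizationTail.last ha).append_left hG.2⟩

lemma ne_nil (h : IsProjFactorizationSeq m n F) : F ≠ [] := by
  obtain ⟨p, G, rfl, -⟩ := h.exists_cons
  exact List.cons_ne_nil p G

lemma odd (h : IsProjFactorizationSeq m n F) (hm : Odd m) (hn : Odd n) :
    ∀ p ∈ F, Odd p.1 ∧ Odd p.2 := by
  obtain ⟨rfl, rfl, -⟩ := h
  exact fun p hp => ⟨hm.of_dvd_nat (List.dvd_prod (List.mem_map_of_mem hp)),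
    hn.of_dvd_nat (List.dvd_prod (List.mem_map_of_mem hp))⟩

end IsProjFactorizationSeq

lemma alternatingLabel_zero (M N m n i j : ℕ) (x : ℤ) :
    alternatingLabel M N m n 0 i j x = x := by
  simp [alternatingLabel]

lemma alternatingLabel_one_one_one (M N m n : ℕ) (x : ℤ) :
    alternatingLabel M N m n 1 1 1 x = M * N - x + (-(m * n) + 3) / 2 := by
  simp [alternatingLabel, Nat.not_odd_iff_even]

/-- The step `Xᵢ₋₁ ↦ Xᵢ` in the construction of `HBBL`, for `p = (mᵢ, nᵢ)`. -/
def HVASC (M N : ℕ) (X : GridLabeling) (p : ℕ × ℕ) : GridLabeling :=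
  VASC M N p.2 (HASC M N p.1 X)

section Iteration

variable {M N : ℕ} {X Y : GridLabeling} {F G : List (ℕ × ℕ)} {p q : ℕ × ℕ}

lemma width_foldl_hvasc (M N : ℕ) (X : GridLabeling) (F : List (ℕ × ℕ)) :
    (F.foldl (HVASC M N) X).width = X.width * (F.map Prod.fst).prod := by
  induction F generalizing X with
  | nil => simp
  | cons p F ih => rw [List.foldl_cons, ih, List.map_cons, List.prod_cons, ← mul_assoc]; rfl

lemma height_foldl_hvasc (M N : ℕ) (X : GridLabeling) (F : List (ℕ × ℕ)) :
    (F.foldl (HVASC M N) X).height = X.height * (F.map Prod.snd).prod := by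
  induction F generalizing X with
  | nil => simp
  | cons p F ih => rw [List.foldl_cons, ih, List.map_cons, List.prod_cons, ← mul_assoc]; rfl

lemma odd_width_of_foldl_hvasc (h : Odd (F.foldl (HVASC M N) X).width) : Odd X.width :=
  h.of_dvd_nat ⟨_, width_foldl_hvasc M N X F⟩

lemma odd_height_of_foldl_hvasc (h : Odd (F.foldl (HVASC M N) X).height) : Odd X.height :=
  h.of_dvd_nat ⟨_, height_foldl_hvasc M N X F⟩

lemma hasc_label_of_le (M N r : ℕ) {i : ℕ} (hi : 1 ≤ i) (hi' : i ≤ X.width) (j : ℕ) :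
    (HASC M N r X).label (i, j) = X.label (i, j) := by
  have lt : i - 1 < X.width := by omega
  simp only [HASC, Nat.div_eq_of_lt lt, Nat.mod_eq_of_lt lt, Nat.sub_add_cancel hi,
    alternatingLabel_zero]

lemma vasc_label_of_le (M N r : ℕ) (i : ℕ) {j : ℕ} (hj : 1 ≤ j) (hj' : j ≤ X.height) :
    (VASC M N r X).label (i, j) = X.label (i, j) := by
  have lt : j - 1 < X.height := by omega
  simp only [VASC, Nat.div_eq_of_lt lt, Nat.mod_eq_of_lt lt, Nat.sub_add_cancel hj,
    alternatingLabel_zero]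

lemma hasc_label_width_add_one (M N r : ℕ) (hX : 0 < X.width) :
    (HASC M N r X).label (X.width + 1, 1) =
      M * N - X.label (1, 1) + (-(X.width * X.height) + 3) / 2 := by
  simp only [HASC, Nat.add_sub_cancel, Nat.div_self hX, Nat.mod_self, zero_add,
    alternatingLabel_one_one_one]

lemma vasc_label_height_add_one (M N r : ℕ) (hX : 0 < X.height) :
    (VASC M N r X).label (1, X.height + 1) =
      M * N - X.label (1, 1) + (-(X.width * X.height) + 3) / 2 := by
  simp only [VASC, Nat.add_sub_cancel, Nat.div_self hX, Nat.mod_self, zero_add,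
    alternatingLabel_one_one_one]

lemma projGridVertices_subset_foldl_hvasc (hF : ∀ p ∈ F, 0 < p.1 ∧ 0 < p.2) :
    projGridVertices X.width X.height ⊆
      projGridVertices (F.foldl (HVASC M N) X).width (F.foldl (HVASC M N) X).height := by
  rw [width_foldl_hvasc, height_foldl_hvasc]
  rintro v ⟨hi, hi', hj, hj'⟩
  exact ⟨hi, hi'.trans (Nat.le_mul_of_pos_right _ (List.prod_pos (by simpa using
      fun a b hab => (hF _ hab).1))),
    hj, hj'.trans (Nat.le_mul_of_pos_right _ (List.prod_pos (by simpa using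
      fun b a hab => (hF _ hab).2)))⟩

lemma foldl_hvasc_label (hF : ∀ p ∈ F, 0 < p.1 ∧ 0 < p.2) :
    Set.EqOn (F.foldl (HVASC M N) X).label X.label (projGridVertices X.width X.height) := by
  induction F generalizing X with
  | nil => exact Set.eqOn_refl _ _
  | cons p F ih =>
    rw [List.forall_mem_cons] at hF
    intro v hv
    have hv' : v ∈ projGridVertices (HVASC M N X p).width (HVASC M N X p).height :=
      projGridVertices_subset_foldl_hvasc (F := [p]) (by simpa using hF.1) hv
    rw [List.foldl_cons, ih hF.2 hv', HVASC,
      vasc_label_of_le (X := HASC M N p.1 X) M N _ _ hv.2.2.1 hv.2.2.2,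
      hasc_label_of_le M N _ hv.1 hv.2.1]

lemma label_eq_of_foldl_hvasc_agrees (hF : ∀ p ∈ F, 0 < p.1 ∧ 0 < p.2)
    (hG : ∀ p ∈ G, 0 < p.1 ∧ 0 < p.2)
    (h : (F.foldl (HVASC M N) X).Agrees (G.foldl (HVASC M N) Y)) {v : ℕ × ℕ}
    (hX : v ∈ projGridVertices X.width X.height) (hY : v ∈ projGridVertices Y.width Y.height) :
    X.label v = Y.label v := by
  rw [← foldl_hvasc_label (M := M) (N := N) hF hX, ← foldl_hvasc_label (M := M) (N := N) hG hY]
  exact h.eqOn (projGridVertices_subset_foldl_hvasc hF hX)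

lemma hvasc_label_width_add_one (hw : 0 < X.width) (hh : 0 < X.height) :
    (HVASC M N X p).label (X.width + 1, 1) =
      M * N - X.label (1, 1) + (-(X.width * X.height) + 3) / 2 := by
  rw [HVASC, vasc_label_of_le (X := HASC M N p.1 X) M N _ _ le_rfl hh,
    hasc_label_width_add_one M N _ hw]

lemma hvasc_label_height_add_one (hw : 0 < X.width) (hh : 0 < X.height) :
    (HVASC M N X p).label (1, X.height + 1) =
      M * N - X.label (1, 1) + (-((X.width * p.1 : ℕ) * X.height) + 3) / 2 := by
  rw [← hasc_label_of_le M N p.1 le_rfl hw 1]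
  exact vasc_label_height_add_one (X := HASC M N p.1 X) M N p.2 hh

lemma foldl_hvasc_label_width_add_one (hF : IsProjFactorizationTail F) (hne : F ≠ [])
    (hw : 0 < X.width) (hh : 0 < X.height) :
    (X.width + 1, 1) ∈
        projGridVertices (F.foldl (HVASC M N) X).width (F.foldl (HVASC M N) X).height ∧
      (F.foldl (HVASC M N) X).label (X.width + 1, 1) =
        M * N - X.label (1, 1) + (-(X.width * X.height) + 3) / 2 := by
  obtain ⟨p, G, rfl⟩ := List.exists_cons_of_ne_nil hne
  obtain ⟨hp, hG⟩ := List.forall_mem_cons.1 hF.pos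
  have hp₁ : 1 < p.1 := by cases hF <;> assumption
  have mem : (X.width + 1, 1) ∈ projGridVertices (HVASC M N X p).width (HVASC M N X p).height :=
    ⟨Nat.le_add_left 1 _, by nlinarith [show (HVASC M N X p).width = X.width * p.1 from rfl],
      le_rfl, Nat.mul_pos hh hp.2⟩
  exact ⟨projGridVertices_subset_foldl_hvasc hG mem,
    (foldl_hvasc_label hG mem).trans (hvasc_label_width_add_one hw hh)⟩

/-- The label next to the first copy of `X` in a horizontal sum reveals the area of `X`. -/
lemma height_eq_of_foldl_hvasc_agrees (hF : IsProjFactorizationTail F)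
    (hG : IsProjFactorizationTail G) (hw : Odd (F.foldl (HVASC M N) X).width)
    (hh : Odd (F.foldl (HVASC M N) X).height) (hXY : X.width = Y.width)
    (h : (F.foldl (HVASC M N) X).Agrees (G.foldl (HVASC M N) Y)) : X.height = Y.height := by
  have hwX := odd_width_of_foldl_hvasc hw
  have hhX := odd_height_of_foldl_hvasc hh
  have hhY := odd_height_of_foldl_hvasc (h.height_eq ▸ hh)
  have nil_iff : F = [] ↔ G = [] := by
    have widths := h.width_eq
    rw [width_foldl_hvasc, width_foldl_hvasc, ← hXY] at widths
    rw [← hF.prod_fst_eq_one_iff, ← hG.prod_fst_eq_one_iff,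
      Nat.eq_of_mul_eq_mul_left hwX.pos widths]
  by_cases hne : F = []
  · obtain rfl := hne
    obtain rfl := nil_iff.1 rfl
    exact h.height_eq
  · have corner : X.label (1, 1) = Y.label (1, 1) :=
      label_eq_of_foldl_hvasc_agrees hF.pos hG.pos h ⟨le_rfl, hwX.pos, le_rfl, hhX.pos⟩
        ⟨le_rfl, hXY ▸ hwX.pos, le_rfl, hhY.pos⟩
    obtain ⟨mem, labelX⟩ :=
      foldl_hvasc_label_width_add_one (M := M) (N := N) hF hne hwX.pos hhX.pos
    obtain ⟨-, labelY⟩ := foldl_hvasc_label_width_add_one (M := M) (N := N) hG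
      (mt nil_iff.2 hne) (hXY ▸ hwX.pos) hhY.pos
    have areas : (X.width * X.height : ℕ) = X.width * Y.height := by
      have hX := Nat.odd_iff.1 (hwX.mul hhX)
      have hY := Nat.odd_iff.1 (hwX.mul hhY)
      have := h.eqOn mem
      rw [labelX, hXY, labelY, corner, ← hXY, ← Nat.cast_mul, ← Nat.cast_mul] at this
      omega
    exact Nat.eq_of_mul_eq_mul_left hwX.pos areas

lemma fst_eq_of_foldl_hvasc_agrees (hF : ∀ r ∈ p :: F, 0 < r.1 ∧ 0 < r.2)
    (hG : ∀ r ∈ q :: G, 0 < r.1 ∧ 0 < r.2) (hp : 1 < p.2) (hq : 1 < q.2)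
    (hw : Odd ((p :: F).foldl (HVASC M N) X).width)
    (hh : Odd ((p :: F).foldl (HVASC M N) X).height)
    (h : ((p :: F).foldl (HVASC M N) X).Agrees ((q :: G).foldl (HVASC M N) X)) :
    p.1 = q.1 := by
  have hwX := odd_width_of_foldl_hvasc hw
  have hhX := odd_height_of_foldl_hvasc hh
  have mem {r : ℕ × ℕ} (hr₁ : 0 < r.1) (hr₂ : 1 < r.2) : (1, X.height + 1) ∈
      projGridVertices (HVASC M N X r).width (HVASC M N X r).height :=
    ⟨le_rfl, Nat.mul_pos hwX.pos hr₁, Nat.le_add_left 1 _,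
      by nlinarith [show (HVASC M N X r).height = X.height * r.2 from rfl, hhX.pos]⟩
  obtain ⟨hp', hF'⟩ := List.forall_mem_cons.1 hF
  obtain ⟨hq', hG'⟩ := List.forall_mem_cons.1 hG
  have labels := label_eq_of_foldl_hvasc_agrees hF' hG' h (mem hp'.1 hp) (mem hq'.1 hq)
  rw [hvasc_label_height_add_one hwX.pos hhX.pos, hvasc_label_height_add_one hwX.pos hhX.pos,
    ← Nat.cast_mul, ← Nat.cast_mul] at labels
  have hp_odd : Odd (X.width * p.1) :=
    odd_width_of_foldl_hvasc (F := F) (X := HVASC M N X p) hw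
  have hq_odd : Odd (X.width * q.1) :=
    odd_width_of_foldl_hvasc (F := G) (X := HVASC M N X q) (h.width_eq ▸ hw)
  have areas : X.width * p.1 * X.height = X.width * q.1 * X.height := by
    have hp := Nat.odd_iff.1 (hp_odd.mul hhX)
    have hq := Nat.odd_iff.1 (hq_odd.mul hhX)
    omega
  exact Nat.eq_of_mul_eq_mul_left hwX.pos (Nat.eq_of_mul_eq_mul_right hhX.pos areas)

theorem eq_of_foldl_hvasc_agrees (hF : IsProjFactorizationTail F)
    (hG : IsProjFactorizationTail G) (hw : Odd (F.foldl (HVASC M N) X).width)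
    (hh : Odd (F.foldl (HVASC M N) X).height)
    (h : (F.foldl (HVASC M N) X).Agrees (G.foldl (HVASC M N) X)) : F = G := by
  have fst_prod : (F.map Prod.fst).prod = (G.map Prod.fst).prod :=
    Nat.eq_of_mul_eq_mul_left (odd_width_of_foldl_hvasc hw).pos
      (by simpa only [width_foldl_hvasc] using h.width_eq)
  have snd_prod : (F.map Prod.snd).prod = (G.map Prod.snd).prod :=
    Nat.eq_of_mul_eq_mul_left (odd_height_of_foldl_hvasc hh).pos
      (by simpa only [height_foldl_hvasc] using h.height_eq)
  induction hF generalizing X G with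
  | nil => exact (hG.prod_fst_eq_one_iff.1 fst_prod.symm).symm
  | last ha =>
    rcases hG with - | - | ⟨-, hq, -⟩
    · exact (IsProjFactorizationTail.last ha).prod_fst_eq_one_iff.1 fst_prod
    · simpa using fst_prod
    · exact absurd (Nat.dvd_one.1 ⟨_, snd_prod⟩) hq.ne'
  | @cons p F hp₁ hp₂ hF ih =>
    rcases hG with - | - | @⟨q, G, hq₁, hq₂, hG⟩
    · exact (hF.cons hp₁ hp₂).prod_fst_eq_one_iff.1 fst_prod
    · exact absurd (Nat.dvd_one.1 ⟨_, snd_prod.symm⟩) hp₂.ne'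
    · have fst_eq : p.1 = q.1 :=
        fst_eq_of_foldl_hvasc_agrees (hF.cons hp₁ hp₂).pos (hG.cons hq₁ hq₂).pos hp₂ hq₂ hw hh h
      have height_eq : X.height * p.2 = X.height * q.2 :=
        height_eq_of_foldl_hvasc_agrees (X := HVASC M N X p) (Y := HVASC M N X q) hF hG hw hh
          (congrArg (X.width * ·) fst_eq) h
      have snd_eq := Nat.eq_of_mul_eq_mul_left (odd_height_of_foldl_hvasc hh).pos height_eq
      obtain rfl : p = q := Prod.ext fst_eq snd_eq
      rw [List.map_cons, List.prod_cons, List.map_cons, List.prod_cons] at fst_prod snd_prod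
      rw [ih hG hw hh h (Nat.eq_of_mul_eq_mul_left (by omega) fst_prod)
        (Nat.eq_of_mul_eq_mul_left (by omega) snd_prod)]

end Iteration

lemma hall_label_one_two (M N m n : ℕ) (hm : Odd m) :
    2 * (HALL M N m n).label (1, 2) = 2 * (M * N) - m + 1 := by
  obtain ⟨k, rfl⟩ := hm
  have half : (2 * k + 1 + 1) / 2 = k + 1 := by omega
  simp only [HALL, half, odd_one, Nat.not_odd_iff_even.2 even_two, if_true, if_false]
  push_cast
  ring

namespace IsProjFactorizationSeq

variable {m n : ℕ} {F G : List (ℕ × ℕ)}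

lemma width_height_hbbl (M N : ℕ) (h : IsProjFactorizationSeq m n F) :
    (HBBL M N F).width = m ∧ (HBBL M N F).height = n := by
  obtain ⟨p, F, rfl, -⟩ := h.exists_cons
  exact ⟨(width_foldl_hvasc M N _ F).trans h.1, (height_foldl_hvasc M N _ F).trans h.2.1⟩

theorem eq_of_hbbl_agrees (hF : IsProjFactorizationSeq m n F)
    (hG : IsProjFactorizationSeq m n G) (hm : Odd m) (hn : Odd n)
    (h : (HBBL m n F).Agrees (HBBL m n G)) : F = G := by
  have hw : Odd (HBBL m n F).width := by rwa [(hF.width_height_hbbl m n).1]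
  have hh : Odd (HBBL m n F).height := by rwa [(hF.width_height_hbbl m n).2]
  have hw' := h.width_eq ▸ hw
  obtain ⟨p, F, rfl, hp₁, hp₂, hF'⟩ := hF.exists_cons
  obtain ⟨q, G, rfl, hq₁, hq₂, hG'⟩ := hG.exists_cons
  have labels := label_eq_of_foldl_hvasc_agrees (v := (1, 2)) hF'.pos hG'.pos h
    ⟨le_rfl, hp₁.le, one_le_two, hp₂⟩ ⟨le_rfl, hq₁.le, one_le_two, hq₂⟩
  have fst_eq : p.1 = q.1 := by
    have := hall_label_one_two m n p.1 p.2 (odd_width_of_foldl_hvasc hw)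
    have := hall_label_one_two m n q.1 q.2 (odd_width_of_foldl_hvasc hw')
    omega
  have snd_eq : p.2 = q.2 :=
    height_eq_of_foldl_hvasc_agrees (X := HALL m n p.1 p.2) (Y := HALL m n q.1 q.2) hF' hG' hw hh
      fst_eq h
  obtain rfl : p = q := Prod.ext fst_eq snd_eq
  rw [eq_of_foldl_hvasc_agrees hF' hG' hw hh h]

theorem eq_of_eqOn_hbbl (hF : IsProjFactorizationSeq m n F) (hG : IsProjFactorizationSeq m n G)
    (hm : Odd m) (hn : Odd n)
    (h : Set.EqOn (HBBL m n F).label (HBBL m n G).label (projGridVertices m n)) : F = G := by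
  obtain ⟨widthF, heightF⟩ := hF.width_height_hbbl m n
  obtain ⟨widthG, heightG⟩ := hG.width_height_hbbl m n
  exact hF.eq_of_hbbl_agrees hG hm hn
    ⟨widthF.trans widthG.symm, heightF.trans heightG.symm, by rwa [widthF, heightF]⟩

theorem eq_of_eqOn_vbbl (hF : IsProjFactorizationSeq n m F) (hG : IsProjFactorizationSeq n m G)
    (hm : Odd m) (hn : Odd n)
    (h : Set.EqOn (VBBL m n F).label (VBBL m n G).label (projGridVertices m n)) : F = G := by
  rw [vbbl_eq_transpose, vbbl_eq_transpose] at h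
  exact hF.eq_of_eqOn_hbbl hG hn hm fun v hv => h (x := v.swap) ⟨hv.2.2.1, hv.2.2.2, hv.1, hv.2.1⟩

lemma exists_isZigzag_hbbl (hF : IsProjFactorizationSeq m n F) (hm : Odd m) (hn : Odd n) :
    ∃ f g, IsZigzag ((HBBL m n F).width * (HBBL m n F).height) (HBBL m n F) f g := by
  obtain ⟨width, height⟩ := hF.width_height_hbbl m n
  rw [width, height]
  exact IsZigzag.exists_hbbl m n hF.ne_nil (hF.odd hm hn)

theorem isStandardBicentrallyBalanced_hbbl (hF : IsProjFactorizationSeq m n F) (hm : Odd m)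
    (hn : Odd n) : IsStandardBicentrallyBalanced m n (HBBL m n F) := by
  obtain ⟨f, g, h⟩ := hF.exists_isZigzag_hbbl hm hn
  obtain ⟨width, height⟩ := hF.width_height_hbbl m n
  simpa only [width, height] using h.isStandardBicentrallyBalanced

theorem isStandardBicentrallyBalanced_vbbl (hF : IsProjFactorizationSeq n m F) (hm : Odd m)
    (hn : Odd n) : IsStandardBicentrallyBalanced m n (VBBL m n F) := by
  obtain ⟨f, g, h⟩ := hF.exists_isZigzag_hbbl hn hm
  obtain ⟨width, height⟩ := hF.width_height_hbbl n m
  rw [mul_comm] at h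
  rw [vbbl_eq_transpose]
  simpa only [GridLabeling.transpose, width, height] using
    IsZigzag.isStandardBicentrallyBalanced (X := (HBBL n m F).transpose) h.transpose

end IsProjFactorizationSeq

theorem mainTheorem1 (m n : ℕ) (hm : 3 ≤ m) (hn : 3 ≤ n) (hm_odd : Odd m) (hn_odd : Odd n) :
    (∀ F : List (ℕ × ℕ), IsProjFactorizationSeq m n F →
      IsStandardBicentrallyBalanced m n (HBBL m n F)) ∧
    (∀ F' : List (ℕ × ℕ), IsProjFactorizationSeq n m F' →
      IsStandardBicentrallyBalanced m n (VBBL m n F')) ∧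
    (∀ F₁ F₂ : List (ℕ × ℕ), IsProjFactorizationSeq m n F₁ → IsProjFactorizationSeq m n F₂ →
      F₁ ≠ F₂ → ¬ Set.EqOn (HBBL m n F₁).label (HBBL m n F₂).label (projGridVertices m n)) ∧
    (∀ F'₁ F'₂ : List (ℕ × ℕ), IsProjFactorizationSeq n m F'₁ → IsProjFactorizationSeq n m F'₂ →
      F'₁ ≠ F'₂ →
        ¬ Set.EqOn (VBBL m n F'₁).label (VBBL m n F'₂).label (projGridVertices m n)) :=
  ⟨fun _ hF => hF.isStandardBicentrallyBalanced_hbbl hm_odd hn_odd,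
    fun _ hF => hF.isStandardBicentrallyBalanced_vbbl hm_odd hn_odd,
    fun _ _ hF hG hne h => hne (hF.eq_of_eqOn_hbbl hG hm_odd hn_odd h),
    fun _ _ hF hG hne h => hne (hF.eq_of_eqOn_vbbl hG hm_odd hn_odd h)⟩
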